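/- Write $\log_0 x=x$, $\log_{j+1}x=\log(\log_j x)$. Fix an integer $K\ge 1$ and $B\in\mathbb R$, and for positive integers $i$ at which $\log_{K-1} i$ is defined and positive put $$\Lambda(K,i,B)=\sum_{m=0}^{K-2}\frac{1}{\prod_{j=0}^{m}\log_j i}+\frac{B}{\prod_{j=0}^{K-1}\log_j i}$$ (so $\Lambda(1,i,B)=B/i$). Let $i_0$ be the least positive integer $i$ such that $\log_{K-1}i$ is defined and positive and $|\Lambda(K,i,B)|/4<1/2$. Let $r_i=\Lambda(K,i,B)/4$ for $i\ge i_0$ and $r_i=r_{i_0}$ for $1\le i<i_0$. Given $p_i\in(0,1)$, $i\ge1$, let $X=(X_k)_{k\ge0}$ be the Markov chain on $\mathbb Z_+$ with $X_0=1$ that moves from $0$ to $1$ with probability $1$ and from $n\ge1$ to $n+1$ with probability $p_n$ and to $n-1$ with probability $1-p_n$. Let $D=\inf\{k\ge1:X_k<X_0\}$ (with $\inf\emptyset=\infty$) and $M=\sup\{X_k:0\le k\le D\}$ ($k$ finite). Below, $a_n\sim b_n$ means $a_n/b_n\to1$ as $n\to\infty$. The empty product is $1$. In each case there is a constant $c>0$,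 depending only on $K$, $B$ and the case (i) or (ii), for which the following holds. (i) If $p_i=\frac12+r_i$ for all $i\ge1$, then, as $n\to\infty$, $$P(M=n,\,D<\infty)\sim\begin{cases}\dfrac{c}{\big(\prod_{j=0}^{K-1}\log_j n\big)\,(\log_K n)^2}, & B=1,\\[2ex] \dfrac{c}{\big(\prod_{j=0}^{K-2}\log_j n\big)\,(\log_{K-1} n)^{B}}, & B>1,\\[2ex] \dfrac{c}{\big(\prod_{j=0}^{K-2}\log_j n\big)\,(\log_{K-1} n)^{2-B}}, & B<1.\end{cases}$$ (ii) If $p_i=\frac12-r_i$ for all $i\ge1$, then, as $n\to\infty$, $$P(M=n,\,D<\infty)\sim\begin{cases}\dfrac{c}{n^{B+2}}, & K=1,\ B>-1,\\[2ex] \dfrac{c}{n(\log n)^2}, & K=1,\ B=-1,\\[2ex] c\,n^{B}, & K=1,\ B<-1,\\[2ex] \dfrac{c}{n^{2}\,\big(\prod_{j=0}^{K-2}\log_j n\big)\,(\log_{K-1} n)^{B}}, & K>1.\end{cases}$$ -/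

import Mathlib

open MeasureTheory Filter Asymptotics

universe u

noncomputable section

namespace Lamperti

/-- The iterated logarithm: `iterLog 0 x = x`, `iterLog 1 x = log x`, and
`iterLog (j + 1) x = log (iterLog j x)`. -/
def iterLog : ℕ → ℝ → ℝ
  | 0, x => x
  | j + 1, x => Real.log (iterLog j x)

/-- The product of the first `j` iterated logarithms: `x · log x ⋯ log_{j-1} x`
(the empty product `1` if `j = 0`). -/
def logProd (j : ℕ) (x : ℝ) : ℝ := ∏ m ∈ Finset.range j, iterLog m x

/-- The perturbation
`Λ(K, i, B) = 1/i + 1/(i log i) + ⋯ + 1/(i log i ⋯ log_{K-2} i) + B/(i log i ⋯ log_{K-1} i)`. -/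
def Lam (K i : ℕ) (B : ℝ) : ℝ :=
  (∑ j ∈ Finset.range (K - 1), 1 / logProd (j + 1) i) + B / logProd K i

/-- The least `i` with `log_{K-1} i > 0` and `|Λ(K, i, B)| / 4 < 1 / 2`. Positivity of
`log_j i` for all `j ≤ K - 1` says that `log_{K-1} i` is a genuine iterated logarithm (no
logarithm of a non-positive number is taken) and that it is positive. -/
def i₀ (K : ℕ) (B : ℝ) : ℕ :=
  sInf {i : ℕ | (∀ j < K, 0 < iterLog j i) ∧ |Lam K i B| / 4 < 1 / 2}

/-- `r_i = Λ(K, i, B) / 4` for `i ≥ i₀`, and `r_i = r_{i₀}` for `i < i₀`. -/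
def r (K : ℕ) (B : ℝ) (i : ℕ) : ℝ :=
  if i₀ K B ≤ i then Lam K i B / 4 else Lam K (i₀ K B) B / 4

/-- One-step transition probabilities of the nearest-neighbour walk on `ℕ` reflected at `0`:
from `0` to `1` with probability one, from `n ≥ 1` to `n + 1` with probability `p n` and
to `n - 1` with probability `1 - p n`. -/
def trans (p : ℕ → ℝ) : ℕ → ℕ → ℝ
  | 0, y => if y = 1 then 1 else 0
  | n + 1, y => if y = n + 2 then p (n + 1) else if y = n then 1 - p (n + 1) else 0

/-- `X` is, under `μ`, a time-homogeneous Markov chain on `ℕ` with one-step transition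
probabilities `T`, started from `x₀`. The Markov property is written in product form. -/
structure IsMarkovChain {Ω : Type u} [MeasurableSpace Ω] (μ : Measure Ω) (X : ℕ → Ω → ℕ)
    (T : ℕ → ℕ → ℝ) (x₀ : ℕ) : Prop where
  measurable : ∀ k, Measurable (X k)
  initial : ∀ᵐ ω ∂μ, X 0 ω = x₀
  step : ∀ (n : ℕ) (x : ℕ → ℕ),
    μ.real {ω | ∀ k ≤ n + 1, X k ω = x k} =
      μ.real {ω | ∀ k ≤ n, X k ω = x k} * T (x n) (x (n + 1))

/-- `D = inf {k ≥ 1 : X_k < X_0}`, with `inf ∅ = ∞`. -/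
def D {Ω : Type u} (X : ℕ → Ω → ℕ) (ω : Ω) : ℕ∞ :=
  ⨅ (k : ℕ) (_ : 1 ≤ k ∧ X k ω < X 0 ω), (k : ℕ∞)

/-- `M = sup {X_k : 0 ≤ k ≤ D}`, with values in `ℕ ∪ {∞}`. -/
def M {Ω : Type u} (X : ℕ → Ω → ℕ) (ω : Ω) : ℕ∞ :=
  ⨆ (k : ℕ) (_ : (k : ℕ∞) ≤ D X ω), (X k ω : ℕ∞)

/-- There is a constant `c > 0`, depending only on `p` and `g`, such that for the reflected
walk with up-probabilities `p` started from `1` one has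
`P(M = n, D < ∞) ∼ c / g n` as `n → ∞`. -/
def HasMaxAsymptotics (p : ℕ → ℝ) (g : ℕ → ℝ) : Prop :=
  ∃ c : ℝ, 0 < c ∧
    ∀ (Ω : Type u) [MeasurableSpace Ω] (μ : Measure Ω) [IsProbabilityMeasure μ]
      (X : ℕ → Ω → ℕ), IsMarkovChain μ X (trans p) 1 →
      (fun n : ℕ => μ.real {ω | M X ω = (n : ℕ∞) ∧ D X ω < ⊤}) ~[atTop]
        (fun n : ℕ => c / g n)

end Lamperti

end

/-! Put `w n = ∏_{i ≤ n} (1 - p i) / p i` and `S n = ∑_{j < n} w j`. Since `S` is harmonic off `0`,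
stopping the walk on exit from `{1, …, n}` gives probability `1 - 1 / S (n + 1)` of reaching `0`
before `n + 1`. Differencing in `n` yields the exact law `P(M = n, D < ∞) = w n / (S n * S (n + 1))`
(`measureReal_max_eq`), and only real analysis remains.

Write `p = 1/2 + s r` with `s = ±1`, and let `L` be a primitive of `Λ`. The logarithm of `(1 - p i)
/ p i` is `-s Λ + O(Λ²)` with `Λ = O(1/i)`, so `w ∼ C exp (-s L)` (`weight_isEquivalent`), where
`exp L` is an explicit product of iterated logarithms.

If `∑ w` converges, `S` has a positive limit and the answer is proportional to `exp (-s L)`. If it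
diverges, any `F → ∞` with `F' ∼ exp (-s L)` satisfies `S ∼ C F`, and the answer is `C⁻¹ exp (-s L)
/ F²`. For `s = 1` an exact primitive exists: `log_K` if `B = 1`, otherwise `(log_{K-1})^{1-B} / (1
- B)`. For `s = -1` and `K > 1`, `x Λ(x) → 1` makes `F = x exp L / 2` work. For `K = 1`, changing
the sign of `B` turns case (ii) into case (i). -/

namespace Lamperti

/-! ### Markov property and the chain killed on leaving `{1, …, n}`. -/

section Chain

variable {Ω : Type u} [MeasurableSpace Ω] {μ : Measure Ω} [IsProbabilityMeasure μ]
  {X : ℕ → Ω → ℕ}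

/-- The event that the path stays in `{1, …, n}` before time `k` and is at `x` at time `k`. -/
def tabooEvent (X : ℕ → Ω → ℕ) (n k x : ℕ) : Set Ω :=
  {ω | (∀ j < k, X j ω ∈ Finset.Icc 1 n) ∧ X k ω = x}

theorem measurableSet_tabooEvent (hX : ∀ k, Measurable (X k)) (n k x : ℕ) :
    MeasurableSet (tabooEvent X n k x) := by
  have h : tabooEvent X n k x =
      (⋂ j ∈ Finset.range k, X j ⁻¹' (Finset.Icc 1 n : Finset ℕ)) ∩ X k ⁻¹' {x} := by
    ext ω
    simp [tabooEvent]
  rw [h]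
  exact (Finset.measurableSet_biInter _ fun j _ => hX j (Set.to_countable _).measurableSet).inter
    (hX k (measurableSet_singleton x))

/-- The Markov property on events that depend on the path up to time `k`. -/
theorem IsMarkovChain.measure_path_inter {T : ℕ → ℕ → ℝ} {x₀ : ℕ}
    (hX : IsMarkovChain μ X T x₀) (hT : ∀ x y, 0 ≤ T x y) (k x y : ℕ)
    (A : Set (Fin (k + 1) → ℕ)) :
    μ.real {ω | (fun i : Fin (k + 1) => X i ω) ∈ A ∧ X k ω = x ∧ X (k + 1) ω = y} =
      μ.real {ω | (fun i : Fin (k + 1) => X i ω) ∈ A ∧ X k ω = x} * T x y := by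
  set Z : Ω → (Fin (k + 1) → ℕ) := fun ω i => X i ω with hZ
  have hZm : Measurable Z := measurable_pi_lambda _ fun i => hX.measurable i
  have hm : ∀ j z, MeasurableSet {ω | X j ω = z} := fun j z =>
    hX.measurable j (measurableSet_singleton z)
  -- The path space is countable, so the two measures need only be compared on single paths, where
  -- the product form of the Markov property applies.
  have key : (μ.restrict {ω | X k ω = x ∧ X (k + 1) ω = y}).map Z =
      ENNReal.ofReal (T x y) • (μ.restrict {ω | X k ω = x}).map Z := by
    refine Measure.ext_of_singleton fun a => ?_
    rw [Measure.smul_apply, Measure.map_apply hZm (measurableSet_singleton a),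
      Measure.map_apply hZm (measurableSet_singleton a),
      Measure.restrict_apply (hZm (measurableSet_singleton a)),
      Measure.restrict_apply (hZm (measurableSet_singleton a))]
    by_cases hax : a (Fin.last k) = x
    · have hs := hX.step k (fun j => if h : j < k + 1 then a ⟨j, h⟩ else y)
      have e1 : {ω | ∀ j ≤ k + 1, X j ω = (if h : j < k + 1 then a ⟨j, h⟩ else y)} =
          Z ⁻¹' {a} ∩ {ω | X k ω = x ∧ X (k + 1) ω = y} := by
        ext ω
        simp only [Set.mem_ofPred_eq, Set.mem_inter_iff, Set.mem_preimage, Set.mem_singleton_iff]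
        constructor
        · intro h
          have h0 : Z ω = a := by
            funext i
            have := h i (by omega)
            rwa [dif_pos i.2] at this
          refine ⟨h0, ?_, by simpa using h (k + 1) le_rfl⟩
          rw [← hax, ← h0]
          simp [hZ]
        · rintro ⟨h0, h1, h2⟩ j hj
          split_ifs with h
          · rw [← h0]
          · rw [show j = k + 1 by omega, h2]
      have e2 : {ω | ∀ j ≤ k, X j ω = (if h : j < k + 1 then a ⟨j, h⟩ else y)} =
          Z ⁻¹' {a} ∩ {ω | X k ω = x} := by
        ext ω
        simp only [Set.mem_ofPred_eq, Set.mem_inter_iff, Set.mem_preimage, Set.mem_singleton_iff]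
        constructor
        · intro h
          have h0 : Z ω = a := by
            funext i
            have := h i (by omega)
            rwa [dif_pos i.2] at this
          refine ⟨h0, ?_⟩
          rw [← hax, ← h0]
          simp [hZ]
        · rintro ⟨h0, h1⟩ j hj
          rw [dif_pos (by omega), ← h0]
      rw [e1, e2] at hs
      have hx : (if h : k < k + 1 then a ⟨k, h⟩ else y) = x := by
        rw [dif_pos (Nat.lt_succ_self k)]
        exact hax
      simp only [hx, lt_irrefl, dite_false] at hs
      rw [← ofReal_measureReal, hs, ENNReal.ofReal_mul' (hT x y), ofReal_measureReal, smul_eq_mul,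
        mul_comm]
    · have e : ∀ ω, Z ω = a → X k ω ≠ x := by
        rintro ω rfl h
        exact hax (by simpa [hZ] using h)
      have e1 : Z ⁻¹' {a} ∩ {ω | X k ω = x ∧ X (k + 1) ω = y} = ∅ := by
        ext ω
        simp only [Set.mem_inter_iff, Set.mem_preimage, Set.mem_singleton_iff, Set.mem_ofPred_eq,
          Set.mem_empty_iff_false, iff_false]
        exact fun h => e ω h.1 h.2.1
      have e2 : Z ⁻¹' {a} ∩ {ω | X k ω = x} = ∅ := by
        ext ω
        simp only [Set.mem_inter_iff, Set.mem_preimage, Set.mem_singleton_iff, Set.mem_ofPred_eq,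
          Set.mem_empty_iff_false, iff_false]
        exact fun h => e ω h.1 h.2
      simp [e1, e2]
  have hA : MeasurableSet A := A.to_countable.measurableSet
  have h := congrArg (fun ν : Measure (Fin (k + 1) → ℕ) => (ν A).toReal) key
  simp only [Measure.smul_apply, Measure.map_apply hZm hA, Measure.restrict_apply (hZm hA),
    smul_eq_mul, ENNReal.toReal_mul, ENNReal.toReal_ofReal (hT x y)] at h
  rw [mul_comm]
  exact h

/-- Forward equation of the killed chain: split according to the position at time `k`, which the
event at time `k + 1` forces to be interior. -/
theorem IsMarkovChain.measureReal_tabooEvent_succ {T : ℕ → ℕ → ℝ} {x₀ : ℕ}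
    (hX : IsMarkovChain μ X T x₀) (hT : ∀ x y, 0 ≤ T x y) (n k y : ℕ) :
    μ.real (tabooEvent X n (k + 1) y) =
      ∑ x ∈ Finset.Icc 1 n, μ.real (tabooEvent X n k x) * T x y := by
  have hstep : ∀ x, μ.real (tabooEvent X n k x) * T x y =
      μ.real (tabooEvent X n k x ∩ X (k + 1) ⁻¹' {y}) := by
    intro x
    have h := hX.measure_path_inter hT k x y {a | ∀ i : Fin (k + 1), (i : ℕ) < k → a i ∈ Finset.Icc 1 n}
    have e : ∀ ω, (∀ i : Fin (k + 1), (i : ℕ) < k → X i ω ∈ Finset.Icc 1 n) ↔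
        ∀ j < k, X j ω ∈ Finset.Icc 1 n := fun ω =>
      ⟨fun h j hj => h ⟨j, by omega⟩ hj, fun h i hi => h i hi⟩
    simp only [Set.mem_ofPred_eq, e] at h
    rw [tabooEvent, ← h]
    congr 1
    ext ω
    simp [and_assoc]
  simp_rw [hstep]
  rw [← measureReal_biUnion_finset]
  · congr 1
    ext ω
    simp only [tabooEvent, Set.mem_ofPred_eq, Set.mem_iUnion, Set.mem_inter_iff, Set.mem_preimage,
      Set.mem_singleton_iff, exists_prop]
    constructor
    · rintro ⟨h, hy⟩
      exact ⟨X k ω, h k (by omega), ⟨fun j hj => h j (by omega), rfl⟩, hy⟩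
    · rintro ⟨x, hx, ⟨h, rfl⟩, hy⟩
      refine ⟨fun j hj => ?_, hy⟩
      rcases Nat.lt_succ_iff_lt_or_eq.1 hj with h' | rfl
      · exact h j h'
      · exact hx
  · intro a _ b _ hab
    refine Set.disjoint_left.2 fun ω h1 h2 => hab ?_
    exact h1.1.2.symm.trans h2.1.2
  · exact fun x _ => (measurableSet_tabooEvent hX.measurable n k x).inter
      (hX.measurable _ (measurableSet_singleton y))

end Chain

end Lamperti

/-! ### Scale function and the exact law of the maximum. -/

namespace Lamperti

/-- The product `∏_{i ≤ n} (1 - p_i) / p_i`. -/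
noncomputable def weight (p : ℕ → ℝ) (n : ℕ) : ℝ :=
  ∏ i ∈ Finset.range n, (1 - p (i + 1)) / p (i + 1)

/-- The scale function of the walk, harmonic away from `0`. -/
noncomputable def scale (p : ℕ → ℝ) (n : ℕ) : ℝ := ∑ j ∈ Finset.range n, weight p j

section Chain

variable {p : ℕ → ℝ}

theorem weight_pos (hp : ∀ i, 1 ≤ i → 0 < p i ∧ p i < 1) (n : ℕ) : 0 < weight p n :=
  Finset.prod_pos fun i _ =>
    div_pos (by linarith [(hp (i + 1) (by omega)).2]) (hp (i + 1) (by omega)).1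

theorem scale_succ (p : ℕ → ℝ) (n : ℕ) : scale p (n + 1) = scale p n + weight p n :=
  Finset.sum_range_succ _ _

theorem weight_succ (p : ℕ → ℝ) (n : ℕ) :
    weight p (n + 1) = weight p n * ((1 - p (n + 1)) / p (n + 1)) :=
  Finset.prod_range_succ _ _

theorem scale_zero (p : ℕ → ℝ) : scale p 0 = 0 := rfl

theorem scale_one (p : ℕ → ℝ) : scale p 1 = 1 := by simp [scale, weight]

theorem scale_mono (hp : ∀ i, 1 ≤ i → 0 < p i ∧ p i < 1) : Monotone (scale p) :=
  monotone_nat_of_le_succ fun n => by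
    rw [scale_succ]; linarith [weight_pos hp n]

theorem scale_pos (hp : ∀ i, 1 ≤ i → 0 < p i ∧ p i < 1) {n : ℕ} (hn : 1 ≤ n) :
    0 < scale p n :=
  lt_of_lt_of_le (by rw [scale_one]; exact one_pos) (scale_mono hp hn)

theorem trans_nonneg (hp : ∀ i, 1 ≤ i → 0 < p i ∧ p i < 1) (x y : ℕ) : 0 ≤ trans p x y := by
  cases x with
  | zero => simp only [trans]; split_ifs <;> norm_num
  | succ x =>
    have := hp (x + 1) (by omega)
    simp only [trans]
    split_ifs <;> linarith

theorem sum_Icc_one (g : ℕ → ℝ) (n : ℕ) :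
    ∑ x ∈ Finset.Icc 1 n, g x = ∑ x ∈ Finset.range n, g (x + 1) := by
  induction n with
  | zero => simp
  | succ n ih => rw [Finset.sum_Icc_succ_top (by omega), ih, Finset.sum_range_succ]

theorem sum_trans_mul (p : ℕ → ℝ) (f : ℕ → ℝ) {n x : ℕ} (hx : x < n) :
    ∑ y ∈ Finset.range (n + 2), trans p (x + 1) y * f y =
      p (x + 1) * f (x + 2) + (1 - p (x + 1)) * f x := by
  have h : ∀ y, trans p (x + 1) y * f y =
      (if y = x + 2 then p (x + 1) * f (x + 2) else 0) +
        (if y = x then (1 - p (x + 1)) * f x else 0) := by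
    intro y
    simp only [trans]
    by_cases h1 : y = x + 2
    · subst h1; simp
    · by_cases h2 : y = x
      · subst h2; simp
      · simp [h1, h2]
  simp_rw [h]
  rw [Finset.sum_add_distrib, Finset.sum_ite_eq', Finset.sum_ite_eq', if_pos, if_pos]
  · simp; omega
  · simp; omega

/-- The event that the path hits `0` before leaving `{0, …, n}`. -/
def returnEvent {Ω : Type u} (X : ℕ → Ω → ℕ) (n : ℕ) : Set Ω := ⋃ k, tabooEvent X n k 0

/-- For a path started at `1`, going below the start means being at `0`, so `D` is the first hitting
time of `0`. -/
theorem max_le_and_return_iff {Ω : Type u} {X : ℕ → Ω → ℕ} {ω : Ω} (h0 : X 0 ω = 1) {n : ℕ} (hn : 1 ≤ n) :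
    (M X ω ≤ (n : ℕ∞) ∧ D X ω < ⊤) ↔ ω ∈ returnEvent X n := by
  have hM : M X ω ≤ (n : ℕ∞) ↔ ∀ k : ℕ, (k : ℕ∞) ≤ D X ω → X k ω ≤ n := by
    simp only [M, iSup₂_le_iff, Nat.cast_le]
  have hDle : ∀ k : ℕ, (k : ℕ∞) ≤ D X ω ↔ ∀ j, 1 ≤ j → X j ω < 1 → k ≤ j := by
    intro k
    simp only [D, le_iInf_iff, h0, and_imp, Nat.cast_le]
  rw [hM]
  simp only [returnEvent, Set.mem_iUnion]
  constructor
  · rintro ⟨h, hD⟩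
    have hex : ∃ j, X j ω = 0 := by
      by_contra hne
      push Not at hne
      have : D X ω = ⊤ := by
        simp only [D, iInf_eq_top, h0]
        rintro j ⟨-, hj⟩
        exact absurd (by omega) (hne j)
      exact hD.ne this
    classical
    refine ⟨Nat.find hex, fun j hj => ?_, Nat.find_spec hex⟩
    have h1 := Nat.find_min hex hj
    refine Finset.mem_Icc.2 ⟨by omega, h j ((hDle j).2 fun i _ hi => ?_)⟩
    exact hj.le.trans (Nat.find_min' hex (by omega))
  · rintro ⟨k, hk, hk0⟩
    have hk1 : 1 ≤ k := by
      rcases Nat.eq_zero_or_pos k with rfl | h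
      · omega
      · exact h
    refine ⟨fun j hj => ?_, ?_⟩
    · rcases lt_or_eq_of_le ((hDle j).1 hj k hk1 (by omega)) with h | rfl
      · exact (Finset.mem_Icc.1 (hk j h)).2
      · omega
    · refine lt_of_le_of_lt (iInf₂_le k ⟨hk1, by omega⟩) (WithTop.coe_lt_top k)

variable {Ω : Type u} [MeasurableSpace Ω] {μ : Measure Ω} [IsProbabilityMeasure μ]
  {X : ℕ → Ω → ℕ}

/-- One step of Dynkin's formula for the killed chain. The two boundary terms are the mass absorbed
at `0` and at `n + 1` at time `k + 1`. -/
theorem sum_tabooEvent_succ (hp : ∀ i, 1 ≤ i → 0 < p i ∧ p i < 1)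
    (hX : IsMarkovChain μ X (trans p) 1) (n k : ℕ) (f : ℕ → ℝ) :
    ∑ x ∈ Finset.range n, μ.real (tabooEvent X n (k + 1) (x + 1)) * f (x + 1) +
        μ.real (tabooEvent X n (k + 1) 0) * f 0 +
        μ.real (tabooEvent X n (k + 1) (n + 1)) * f (n + 1) =
      ∑ x ∈ Finset.range n, μ.real (tabooEvent X n k (x + 1)) *
        (p (x + 1) * f (x + 2) + (1 - p (x + 1)) * f x) := by
  rw [← Finset.sum_range_succ' (fun x => μ.real (tabooEvent X n (k + 1) x) * f x),
    ← Finset.sum_range_succ (fun x => μ.real (tabooEvent X n (k + 1) x) * f x)]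
  simp_rw [hX.measureReal_tabooEvent_succ (trans_nonneg hp), Finset.sum_mul]
  rw [Finset.sum_comm, sum_Icc_one]
  refine Finset.sum_congr rfl fun x hx => ?_
  rw [← sum_trans_mul p f (Finset.mem_range.1 hx), Finset.mul_sum]
  exact Finset.sum_congr rfl fun y _ => by ring

theorem sum_tabooEvent_zero (hX : IsMarkovChain μ X (trans p) 1) {n : ℕ} (hn : 1 ≤ n)
    (f : ℕ → ℝ) :
    ∑ x ∈ Finset.range n, μ.real (tabooEvent X n 0 (x + 1)) * f (x + 1) = f 1 := by
  have h1 : μ.real (tabooEvent X n 0 1) = 1 := by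
    have : tabooEvent X n 0 1 =ᵐ[μ] Set.univ := by
      filter_upwards [hX.initial] with ω hω
      simp only [eq_iff_iff, Set.univ]
      exact ⟨fun _ => trivial, fun _ => ⟨fun j hj => absurd hj (Nat.not_lt_zero j), hω⟩⟩
    rw [measureReal_congr this, probReal_univ]
  rw [Finset.sum_eq_single_of_mem 0 (Finset.mem_range.2 hn)]
  · simp [h1]
  · intro x _ hx
    have : tabooEvent X n 0 (x + 1) =ᵐ[μ] (∅ : Set Ω) := by
      filter_upwards [hX.initial] with ω hω
      simp only [eq_iff_iff]
      exact ⟨fun h => hx (by have := h.2; omega), fun h => h.elim⟩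
    rw [measureReal_congr this]
    simp

theorem scale_harmonic (hp : ∀ i, 1 ≤ i → 0 < p i ∧ p i < 1) (x : ℕ) :
    p (x + 1) * scale p (x + 2) + (1 - p (x + 1)) * scale p x = scale p (x + 1) := by
  have := (hp (x + 1) (by omega)).1.ne'
  rw [scale_succ p (x + 1), scale_succ p x, weight_succ]
  field_simp
  ring

/-- The increments of `scale` along the walk have mean zero, so the mean of the square grows by the
one-step variance; only the contribution of the upward step is kept. -/
theorem scale_sq_subharmonic (hp : ∀ i, 1 ≤ i → 0 < p i ∧ p i < 1) (x : ℕ) :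
    scale p (x + 1) ^ 2 + p (x + 1) * weight p (x + 1) ^ 2 ≤
      p (x + 1) * scale p (x + 2) ^ 2 + (1 - p (x + 1)) * scale p x ^ 2 := by
  have hx := hp (x + 1) (by omega)
  have h := scale_harmonic hp x
  have h1 := scale_succ p (x + 1)
  have h2 := scale_succ p x
  have h3 : 0 ≤ (1 - p (x + 1)) * weight p x ^ 2 :=
    mul_nonneg (by linarith) (sq_nonneg _)
  rw [h1] at h ⊢
  rw [show scale p x = scale p (x + 1) - weight p x by linarith] at h ⊢
  have h4 : p (x + 1) * weight p (x + 1) - (1 - p (x + 1)) * weight p x = 0 := by linarith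
  linear_combination h3 - 2 * scale p (x + 1) * h4

/-- The walk leaves `{1, …, n}` almost surely. -/
theorem tendsto_sum_tabooEvent (hp : ∀ i, 1 ≤ i → 0 < p i ∧ p i < 1)
    (hX : IsMarkovChain μ X (trans p) 1) {n : ℕ} (hn : 1 ≤ n) :
    Tendsto (fun k => ∑ x ∈ Finset.range n, μ.real (tabooEvent X n k (x + 1))) atTop
      (nhds 0) := by
  obtain ⟨x₀, -, hx₀⟩ := Finset.exists_min_image (Finset.range n)
    (fun x => p (x + 1) * weight p (x + 1) ^ 2) ⟨0, Finset.mem_range.2 hn⟩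
  set δ := p (x₀ + 1) * weight p (x₀ + 1) ^ 2 with hδ
  have hδ0 : 0 < δ := mul_pos (hp _ (by omega)).1 (pow_pos (weight_pos hp _) 2)
  -- A Lyapunov function: nonnegative on `{0, …, n + 1}`, and its mean drops by at least `δ` per
  -- step from every interior point. Hence `δ` times the total expected time spent inside is at most
  -- `V 0`, and the survival probabilities are summable.
  set ψ : ℕ → ℝ := fun x => scale p (n + 1) ^ 2 - scale p x ^ 2 with hψ
  have hψ0 : ∀ x ≤ n + 1, 0 ≤ ψ x := fun x hx => by
    have h1 := scale_mono hp hx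
    have h2 := scale_mono hp (Nat.zero_le x)
    rw [scale_zero] at h2
    exact sub_nonneg.2 (pow_le_pow_left₀ h2 h1 2)
  set V : ℕ → ℝ := fun k =>
    ∑ x ∈ Finset.range n, μ.real (tabooEvent X n k (x + 1)) * ψ (x + 1) with hV
  set a : ℕ → ℝ := fun k => ∑ x ∈ Finset.range n, μ.real (tabooEvent X n k (x + 1)) with ha
  have hVstep : ∀ k, V (k + 1) ≤ V k - δ * a k := by
    intro k
    have h := sum_tabooEvent_succ hp hX n k ψ
    have h1 : 0 ≤ μ.real (tabooEvent X n (k + 1) 0) * ψ 0 :=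
      mul_nonneg measureReal_nonneg (hψ0 _ (by omega))
    have h2 : 0 ≤ μ.real (tabooEvent X n (k + 1) (n + 1)) * ψ (n + 1) :=
      mul_nonneg measureReal_nonneg (hψ0 _ le_rfl)
    have h3 : ∑ x ∈ Finset.range n, μ.real (tabooEvent X n k (x + 1)) *
        (p (x + 1) * ψ (x + 2) + (1 - p (x + 1)) * ψ x) ≤ V k - δ * a k := by
      rw [hV, ha]
      simp only
      rw [Finset.mul_sum, ← Finset.sum_sub_distrib]
      refine Finset.sum_le_sum fun x hx => ?_
      have h4 := scale_sq_subharmonic hp x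
      have h5 := hx₀ x hx
      have h6 : p (x + 1) * ψ (x + 2) + (1 - p (x + 1)) * ψ x ≤ ψ (x + 1) - δ := by
        simp only [hψ]
        linarith
      have := mul_le_mul_of_nonneg_left h6 (measureReal_nonneg (μ := μ)
        (s := tabooEvent X n k (x + 1)))
      linarith
    simp only [hV] at h3 ⊢
    linarith
  have hV0 : ∀ k, 0 ≤ V k := fun k => Finset.sum_nonneg fun x hx =>
    mul_nonneg measureReal_nonneg (hψ0 _ (by have := Finset.mem_range.1 hx; omega))
  have ha0 : ∀ k, 0 ≤ a k := fun k => Finset.sum_nonneg fun x _ => measureReal_nonneg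
  have hsum : ∀ k, δ * ∑ j ∈ Finset.range k, a j ≤ V 0 - V k := by
    intro k
    induction k with
    | zero => simp
    | succ k ih =>
      rw [Finset.sum_range_succ, mul_add]
      linarith [hVstep k]
  refine (summable_of_sum_range_le (c := V 0 / δ) ha0 fun k => ?_).tendsto_atTop_zero
  rw [le_div_iff₀ hδ0]
  linarith [hsum k, hV0 k]

theorem measurableSet_returnEvent (hX : ∀ k, Measurable (X k)) (n : ℕ) :
    MeasurableSet (returnEvent X n) :=
  MeasurableSet.iUnion fun k => measurableSet_tabooEvent hX n k 0

/-- The function `φ = 1 - scale / scale (n + 1)` is harmonic inside, with boundary values `1` at `0`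
and `0` at `n + 1`. The mass absorbed at `0` therefore telescopes to `φ 1` minus a remainder bounded
by the survival probability. -/
theorem measureReal_returnEvent (hp : ∀ i, 1 ≤ i → 0 < p i ∧ p i < 1)
    (hX : IsMarkovChain μ X (trans p) 1) {n : ℕ} (hn : 1 ≤ n) :
    μ.real (returnEvent X n) = 1 - 1 / scale p (n + 1) := by
  have hS : 0 < scale p (n + 1) := scale_pos hp (by omega)
  set φ : ℕ → ℝ := fun x => 1 - scale p x / scale p (n + 1) with hφ
  have hφ0 : φ 0 = 1 := by simp [hφ, scale_zero]
  have hφn : φ (n + 1) = 0 := by simp [hφ, hS.ne']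
  have hφ1 : φ 1 = 1 - 1 / scale p (n + 1) := by simp [hφ, scale_one]
  have hharm : ∀ x, p (x + 1) * φ (x + 2) + (1 - p (x + 1)) * φ x = φ (x + 1) := by
    intro x
    have := scale_harmonic hp x
    simp only [hφ]
    rw [← this]
    ring
  have hb : ∀ x ≤ n + 1, 0 ≤ φ x ∧ φ x ≤ 1 := by
    intro x hx
    have h1 := scale_mono hp hx
    have h2 := scale_mono hp (Nat.zero_le x)
    rw [scale_zero] at h2
    exact ⟨sub_nonneg.2 ((div_le_one hS).2 h1), sub_le_self _ (div_nonneg h2 hS.le)⟩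
  set V : ℕ → ℝ := fun k =>
    ∑ x ∈ Finset.range n, μ.real (tabooEvent X n k (x + 1)) * φ (x + 1) with hV
  have hVstep : ∀ k, V (k + 1) + μ.real (tabooEvent X n (k + 1) 0) = V k := by
    intro k
    have h := sum_tabooEvent_succ hp hX n k φ
    simp only [hharm, hφ0, hφn, mul_one, mul_zero, add_zero] at h
    exact h
  have h0 : μ.real (tabooEvent X n 0 0) = 0 := by
    have : tabooEvent X n 0 0 =ᵐ[μ] (∅ : Set Ω) := by
      filter_upwards [hX.initial] with ω hω
      simp only [eq_iff_iff]
      exact ⟨fun h => by have := h.2; omega, fun h => h.elim⟩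
    rw [measureReal_congr this]
    simp
  have hpart : ∀ k, ∑ j ∈ Finset.range (k + 1), μ.real (tabooEvent X n j 0) = φ 1 - V k := by
    intro k
    induction k with
    | zero => simp [h0, hV, sum_tabooEvent_zero hX hn]
    | succ k ih =>
      rw [Finset.sum_range_succ, ih]
      linarith [hVstep k]
  have hVlim : Tendsto V atTop (nhds 0) := by
    refine squeeze_zero (fun k => Finset.sum_nonneg fun x hx => ?_)
      (fun k => Finset.sum_le_sum fun x hx => ?_) (tendsto_sum_tabooEvent hp hX hn)
    · exact mul_nonneg measureReal_nonneg
        (hb _ (by have := Finset.mem_range.1 hx; omega)).1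
    · exact mul_le_of_le_one_right measureReal_nonneg
        (hb _ (by have := Finset.mem_range.1 hx; omega)).2
  -- The taboo forbids `0` before the final time, so distinct hitting times exclude each other.
  have hdisj : Pairwise (Function.onFun Disjoint fun k => tabooEvent X n k 0) := by
    intro i j hij
    refine Set.disjoint_left.2 fun ω hi hj => ?_
    rcases lt_or_gt_of_ne hij with h | h
    · have := hj.1 i h
      rw [hi.2] at this
      simp at this
    · have := hi.1 j h
      rw [hj.2] at this
      simp at this
  have hsum : HasSum (fun k => μ.real (tabooEvent X n k 0)) (μ.real (returnEvent X n)) := by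
    have h := measure_iUnion (μ := μ) hdisj
      fun k => measurableSet_tabooEvent hX.measurable n k 0
    have hfin : ∑' k, μ (tabooEvent X n k 0) ≠ ⊤ := by
      rw [← h]; exact measure_ne_top _ _
    have := ENNReal.hasSum_toReal hfin
    rwa [← ENNReal.tsum_toReal_eq fun k => measure_ne_top _ _, ← h] at this
  have hlim := (hsum.tendsto_sum_nat).comp (tendsto_add_atTop_nat 1)
  have hlim' : Tendsto (fun k => ∑ j ∈ Finset.range (k + 1), μ.real (tabooEvent X n j 0)) atTop
      (nhds (φ 1 - 0)) := by
    simp_rw [hpart]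
    exact tendsto_const_nhds.sub hVlim
  rw [tendsto_nhds_unique hlim hlim', sub_zero, hφ1]

/-- The event is the difference of the return events at levels `n` and `n - 1`. With `2 ≤ n` both
levels contain the starting point, and the probability is `1 / scale n - 1 / scale (n + 1)`. -/
theorem measureReal_max_eq (hp : ∀ i, 1 ≤ i → 0 < p i ∧ p i < 1)
    (hX : IsMarkovChain μ X (trans p) 1) {n : ℕ} (hn : 2 ≤ n) :
    μ.real {ω | M X ω = (n : ℕ∞) ∧ D X ω < ⊤} =
      weight p n / (scale p n * scale p (n + 1)) := by
  obtain ⟨m, rfl⟩ : ∃ m, n = m + 1 := ⟨n - 1, by omega⟩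
  have hm : 1 ≤ m := by omega
  have hsub : returnEvent X m ⊆ returnEvent X (m + 1) := by
    refine Set.iUnion_mono fun k ω h => ⟨fun j hj => ?_, h.2⟩
    have := Finset.mem_Icc.1 (h.1 j hj)
    exact Finset.mem_Icc.2 ⟨this.1, by omega⟩
  have hev : {ω | M X ω = ((m + 1 : ℕ) : ℕ∞) ∧ D X ω < ⊤} =ᵐ[μ]
      (returnEvent X (m + 1) \ returnEvent X m : Set Ω) := by
    filter_upwards [hX.initial] with ω h0
    have h1 := max_le_and_return_iff h0 hm
    have h2 := max_le_and_return_iff h0 (show 1 ≤ m + 1 by omega)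
    have h3 : M X ω = ((m + 1 : ℕ) : ℕ∞) ↔
        M X ω ≤ ((m + 1 : ℕ) : ℕ∞) ∧ ¬ M X ω ≤ (m : ℕ∞) := by
      rw [le_antisymm_iff, not_le, Nat.cast_add, Nat.cast_one,
        ENat.add_one_le_iff (ENat.natCast_ne_top m)]
    refine eq_iff_iff.2 ?_
    change (M X ω = ((m + 1 : ℕ) : ℕ∞) ∧ D X ω < ⊤) ↔
      (ω ∈ returnEvent X (m + 1) ∧ ¬ ω ∈ returnEvent X m)
    rw [← h1, ← h2, h3]
    tauto
  have hs1 : 0 < scale p (m + 1) := scale_pos hp (by omega)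
  have hs2 : 0 < scale p (m + 1 + 1) := scale_pos hp (by omega)
  rw [measureReal_congr hev, measureReal_sdiff hsub (measurableSet_returnEvent hX.measurable m),
    measureReal_returnEvent hp hX hm, measureReal_returnEvent hp hX (by omega)]
  have := scale_succ p (m + 1)
  field_simp
  linarith

end Chain

end Lamperti

namespace Lamperti

/-! ### Iterated logarithms and the bound `|r| < 1/2`. -/

section IterLog

theorem logProd_succ (m : ℕ) (x : ℝ) : logProd (m + 1) x = logProd m x * iterLog m x :=
  Finset.prod_range_succ _ _

theorem logProd_zero (x : ℝ) : logProd 0 x = 1 := rfl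

theorem tendsto_iterLog (j : ℕ) : Tendsto (iterLog j) atTop atTop := by
  induction j with
  | zero => exact tendsto_id
  | succ j ih => exact Real.tendsto_log_atTop.comp ih

theorem eventually_iterLog_ge (K : ℕ) (a : ℝ) : ∀ᶠ x in atTop, ∀ j < K, a ≤ iterLog j x := by
  have h := (Finset.eventually_all (Finset.range K)).2
    fun j _ => (tendsto_iterLog j).eventually_ge_atTop a
  filter_upwards [h] with x hx j hj using hx j (Finset.mem_range.2 hj)

theorem logProd_pos {m : ℕ} {x : ℝ} (h : ∀ j < m, 0 < iterLog j x) : 0 < logProd m x :=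
  Finset.prod_pos fun j hj => h j (Finset.mem_range.1 hj)

theorem iterLog_mono {K : ℕ} {x y : ℝ} (hx : ∀ j < K, 0 < iterLog j x) (hxy : x ≤ y) :
    ∀ j ≤ K, iterLog j x ≤ iterLog j y := by
  intro j
  induction j with
  | zero => exact fun _ => hxy
  | succ j ih => exact fun hj => Real.log_le_log (hx j hj) (ih (by omega))

theorem iterLog_pos_of_le {K : ℕ} {x y : ℝ} (hx : ∀ j < K, 0 < iterLog j x) (hxy : x ≤ y) :
    ∀ j < K, 0 < iterLog j y :=
  fun j hj => (hx j hj).trans_le (iterLog_mono hx hxy j hj.le)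

theorem logProd_mono {K : ℕ} {x y : ℝ} (hx : ∀ j < K, 0 < iterLog j x) (hxy : x ≤ y) {m : ℕ}
    (hm : m ≤ K) : logProd m x ≤ logProd m y :=
  Finset.prod_le_prod (fun j hj => (hx j (by have := Finset.mem_range.1 hj; omega)).le)
    fun j hj => iterLog_mono hx hxy j (by have := Finset.mem_range.1 hj; omega)

theorem hasDerivAt_iterLog (m : ℕ) {x : ℝ} (h : ∀ j < m, 0 < iterLog j x) :
    HasDerivAt (iterLog m) (1 / logProd m x) x := by
  induction m with
  | zero =>
    rw [logProd_zero, div_one]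
    exact hasDerivAt_id x
  | succ m ih =>
    have h1 := (ih fun j hj => h j (by omega)).log (h m (by omega)).ne'
    rw [logProd_succ, ← div_div]
    exact h1

theorem one_lt_iterLog {K : ℕ} {x : ℝ} (h : ∀ j < K, 0 < iterLog j x) {j : ℕ}
    (hj : j + 1 < K) : 1 < iterLog j x :=
  (Real.log_pos_iff (h j (by omega)).le).1 (h (j + 1) hj)

theorem le_logProd_succ {x : ℝ} (hx : 0 ≤ x) {m : ℕ} (h : ∀ j ≤ m, 1 ≤ j → 1 ≤ iterLog j x) :
    x ≤ logProd (m + 1) x := by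
  induction m with
  | zero => simp [logProd_succ, logProd_zero, iterLog]
  | succ m ih =>
    have h1 := ih fun j hj => h j (by omega)
    rw [logProd_succ]
    exact h1.trans (le_mul_of_one_le_right (hx.trans h1) (h (m + 1) le_rfl (by omega)))

/-- Each logarithm lowers its argument by at least one, by `log y ≤ y - 1`. -/
theorem iterLog_add_le {K : ℕ} {x : ℝ} (h : ∀ j < K, 0 < iterLog j x) {j : ℕ} (hj : j ≤ K) :
    iterLog j x + j ≤ x := by
  induction j with
  | zero => simp [iterLog]
  | succ j ih =>
    have h1 := ih (by omega)
    have h2 := Real.log_le_sub_one_of_pos (h j (by omega))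
    change Real.log (iterLog j x) + _ ≤ _
    push_cast
    linarith

/-- The function `Λ(K, x, B)` of a real variable `x`, with `K = k + 1`. -/
noncomputable def lamReal (k : ℕ) (B x : ℝ) : ℝ :=
  (∑ j ∈ Finset.range k, 1 / logProd (j + 1) x) + B / logProd (k + 1) x

theorem Lam_eq (k i : ℕ) (B : ℝ) : Lam (k + 1) i B = lamReal k B i := rfl

theorem tendsto_logProd (m : ℕ) : Tendsto (logProd (m + 1)) atTop atTop := by
  refine tendsto_atTop_mono' atTop ?_ tendsto_id
  filter_upwards [eventually_ge_atTop 0, eventually_iterLog_ge (m + 1) 1] with x hx h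
  exact le_logProd_succ hx fun j hj _ => h j (by omega)

theorem tendsto_lamReal (k : ℕ) (B : ℝ) : Tendsto (lamReal k B) atTop (nhds 0) := by
  have h1 := tendsto_finsetSum (Finset.range k)
    fun j _ => (tendsto_logProd j).const_div_atTop (1 : ℝ)
  have h2 := (tendsto_logProd k).const_div_atTop B
  have h3 := h1.add h2
  rw [Finset.sum_const_zero, add_zero] at h3
  exact h3

/-- The set of admissible indices in the definition of `i₀` is nonempty. -/
theorem i₀_mem (k : ℕ) (B : ℝ) :
    (∀ j < k + 1, 0 < iterLog j (i₀ (k + 1) B)) ∧ |Lam (k + 1) (i₀ (k + 1) B) B| / 4 < 1 / 2 := by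
  refine Nat.sInf_mem
    (s := {i : ℕ | (∀ j < k + 1, 0 < iterLog j i) ∧ |Lam (k + 1) i B| / 4 < 1 / 2}) ?_
  have h1 : ∀ᶠ x : ℝ in atTop, |lamReal k B x| < 2 := by
    have h := (tendsto_lamReal k B).abs
    rw [abs_zero] at h
    exact h.eventually_lt_const two_pos
  obtain ⟨i, hi⟩ := ((tendsto_natCast_atTop_atTop (R := ℝ)).eventually
    (h1.and (eventually_iterLog_ge (k + 1) 1))).exists
  exact ⟨i, fun j hj => one_pos.trans_le (hi.2 j hj), by rw [Lam_eq]; linarith [hi.1]⟩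

/-- Over the common denominator the numerator is nondecreasing in `x`, which `lamReal` itself need
not be. -/
theorem lamReal_eq_div {k : ℕ} {x : ℝ} (h : ∀ j < k + 1, 0 < iterLog j x) (B : ℝ) :
    lamReal k B x = (∑ j ∈ Finset.range k, ∏ m ∈ Finset.Ico (j + 1) (k + 1), iterLog m x + B) /
      logProd (k + 1) x := by
  rw [lamReal, add_div, Finset.sum_div]
  congr 1
  refine Finset.sum_congr rfl fun j hj => ?_
  have hj' := Finset.mem_range.1 hj
  have h1 : logProd (k + 1) x =
      logProd (j + 1) x * ∏ m ∈ Finset.Ico (j + 1) (k + 1), iterLog m x :=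
    (Finset.prod_range_mul_prod_Ico _ (by omega)).symm
  have h2 : 0 < logProd (j + 1) x := logProd_pos fun i hi => h i (by omega)
  have h3 : 0 < ∏ m ∈ Finset.Ico (j + 1) (k + 1), iterLog m x :=
    Finset.prod_pos fun m hm => h m (Finset.mem_Ico.1 hm).2
  rw [h1]
  field_simp

/-- Each of the `k` terms is at most `1 / x`, and `x ≥ k + log_k x > k`. -/
theorem sum_inv_logProd_le_one {k : ℕ} {x : ℝ} (h : ∀ j < k + 1, 0 < iterLog j x) :
    ∑ j ∈ Finset.range k, 1 / logProd (j + 1) x ≤ 1 := by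
  have hx : 0 < x := h 0 (by omega)
  have h1 : ∑ j ∈ Finset.range k, 1 / logProd (j + 1) x ≤ ∑ j ∈ Finset.range k, 1 / x := by
    refine Finset.sum_le_sum fun j hj => one_div_le_one_div_of_le hx ?_
    refine le_logProd_succ hx.le fun i hi _ => (one_lt_iterLog h ?_).le
    have := Finset.mem_range.1 hj
    omega
  refine h1.trans ?_
  have h2 := iterLog_add_le h (Nat.le_succ k)
  have h3 := h k (by omega)
  rw [Finset.sum_const, Finset.card_range, nsmul_eq_mul, mul_one_div, div_le_one hx]
  linarith

/-- Propagates the bound from `i₀` to all later indices. The lower bound says `numerator > -2 *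
logProd`, and numerator and `logProd` both grow. For the upper bound, every term decreases when `B ≥
0`; when `B < 0` the sum is at most `1` and the last term is nonpositive. -/
theorem abs_lamReal_lt_two {k : ℕ} {B x y : ℝ} (h : ∀ j < k + 1, 0 < iterLog j x)
    (hx : |lamReal k B x| < 2) (hxy : x ≤ y) : |lamReal k B y| < 2 := by
  have h' := iterLog_pos_of_le h hxy
  rw [abs_lt] at hx ⊢
  have hpx := logProd_pos h
  have hpy := logProd_pos h'
  constructor
  · have h1 := hx.1
    rw [lamReal_eq_div h, lt_div_iff₀ hpx] at h1
    rw [lamReal_eq_div h', lt_div_iff₀ hpy]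
    have h2 : ∑ j ∈ Finset.range k, ∏ m ∈ Finset.Ico (j + 1) (k + 1), iterLog m x ≤
        ∑ j ∈ Finset.range k, ∏ m ∈ Finset.Ico (j + 1) (k + 1), iterLog m y :=
      Finset.sum_le_sum fun j _ => Finset.prod_le_prod
        (fun m hm => (h m (Finset.mem_Ico.1 hm).2).le)
        fun m hm => iterLog_mono h hxy m (Finset.mem_Ico.1 hm).2.le
    have h3 := logProd_mono h hxy le_rfl
    linarith
  · rcases le_or_gt 0 B with hB | hB
    · refine lt_of_le_of_lt ?_ hx.2
      refine add_le_add (Finset.sum_le_sum fun j hj => ?_)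
        (div_le_div_of_nonneg_left hB hpx (logProd_mono h hxy le_rfl))
      have hj' := Finset.mem_range.1 hj
      exact one_div_le_one_div_of_le (logProd_pos fun i hi => h i (by omega))
        (logProd_mono h hxy (by omega))
    · have h1 := sum_inv_logProd_le_one h'
      have h2 : B / logProd (k + 1) y ≤ 0 := div_nonpos_of_nonpos_of_nonneg hB.le hpy.le
      rw [lamReal]
      linarith

theorem abs_r_lt (k : ℕ) (B : ℝ) (i : ℕ) : |r (k + 1) B i| < 1 / 2 := by
  obtain ⟨h, hl⟩ := i₀_mem k B
  rw [Lam_eq] at hl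
  have key : ∀ y : ℝ, (i₀ (k + 1) B : ℝ) ≤ y → |lamReal k B y / 4| < 1 / 2 := by
    intro y hy
    have := abs_lamReal_lt_two h (by linarith) hy
    rw [abs_div, abs_of_pos (four_pos : (0 : ℝ) < 4)]
    linarith
  rw [r]
  split_ifs with hi
  · exact key i (Nat.cast_le.2 hi)
  · exact key _ le_rfl

end IterLog

/-! ### Asymptotics of the weights. -/

section Weight

/-- A primitive of `Λ(k + 1, ·, B)`. -/
noncomputable def lamPrim (k : ℕ) (B x : ℝ) : ℝ :=
  ∑ j ∈ Finset.range k, iterLog (j + 1) x + B * iterLog (k + 1) x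

theorem hasDerivAt_lamPrim {k : ℕ} {x : ℝ} (h : ∀ j < k + 1, 0 < iterLog j x) (B : ℝ) :
    HasDerivAt (lamPrim k B) (lamReal k B x) x := by
  have h1 : HasDerivAt (fun x => ∑ j ∈ Finset.range k, iterLog (j + 1) x)
      (∑ j ∈ Finset.range k, 1 / logProd (j + 1) x) x :=
    HasDerivAt.fun_sum fun j hj => hasDerivAt_iterLog (j + 1) fun i hi =>
      h i (by have := Finset.mem_range.1 hj; omega)
  have h2 := (hasDerivAt_iterLog (k + 1) h).const_mul B
  rw [mul_one_div] at h2
  exact h1.add h2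

theorem exp_lamPrim {k : ℕ} {x : ℝ} (h : ∀ j < k + 1, 0 < iterLog j x) (B : ℝ) :
    Real.exp (lamPrim k B x) = logProd k x * iterLog k x ^ B := by
  rw [lamPrim, Real.exp_add, Real.exp_sum, Real.rpow_def_of_pos (h k (by omega)), mul_comm B]
  congr 1
  exact Finset.prod_congr rfl fun j hj =>
    Real.exp_log (h j (by have := Finset.mem_range.1 hj; omega))

theorem summable_sub_succ_of_antitone {a : ℕ → ℝ} {l : ℝ} (ha : ∀ᶠ n in atTop, a (n + 1) ≤ a n)
    (hl : Tendsto a atTop (nhds l)) : Summable fun n => a n - a (n + 1) := by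
  obtain ⟨N, hN⟩ := eventually_atTop.1 ha
  rw [← summable_nat_add_iff N]
  have hanti : Antitone fun n => a (n + N) := antitone_nat_of_succ_le fun n => by
    have := hN (n + N) (by omega)
    rwa [show n + 1 + N = n + N + 1 by omega]
  have hge : ∀ n, l ≤ a (n + N) :=
    hanti.le_of_tendsto ((tendsto_add_atTop_iff_nat N).2 hl)
  refine summable_of_sum_range_le (c := a (0 + N) - l)
    (fun n => sub_nonneg.2 (hN (n + N) (by omega))) fun n => ?_
  have := Finset.sum_range_sub' (fun n => a (n + N)) n
  simp only [show ∀ n, n + 1 + N = n + N + 1 by intro n; omega] at this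
  rw [this]
  linarith [hge n]

/-- By the mean value theorem the `n`-th term is `1 / logProd ξ - 1 / logProd (n + 1)` with `n < ξ <
n + 1`, which is dominated by a telescoping difference. -/
theorem summable_iterLog_sub (m : ℕ) :
    Summable fun n : ℕ => iterLog (m + 1) ((n + 1 : ℕ) : ℝ) - iterLog (m + 1) (n : ℝ) -
      1 / logProd (m + 1) ((n + 1 : ℕ) : ℝ) := by
  have hev := (tendsto_natCast_atTop_atTop (R := ℝ)).eventually (eventually_iterLog_ge (m + 1) 1)
  have hpos : ∀ᶠ n : ℕ in atTop, ∀ j < m + 1, 0 < iterLog j (n : ℝ) := by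
    filter_upwards [hev] with n h j hj using one_pos.trans_le (h j hj)
  have hsum : Summable fun n : ℕ =>
      1 / logProd (m + 1) (n : ℝ) - 1 / logProd (m + 1) ((n + 1 : ℕ) : ℝ) := by
    refine summable_sub_succ_of_antitone (l := 0)
      (a := fun n : ℕ => 1 / logProd (m + 1) (n : ℝ)) ?_
      (((tendsto_logProd m).const_div_atTop 1).comp tendsto_natCast_atTop_atTop)
    filter_upwards [hpos] with n h
    exact one_div_le_one_div_of_le (logProd_pos h) (logProd_mono h (by simp) le_rfl)
  refine Summable.of_norm_bounded_eventually_nat hsum ?_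
  filter_upwards [hpos] with n h
  have hlt : (n : ℝ) < ((n + 1 : ℕ) : ℝ) := by simp
  obtain ⟨ξ, hξ, hd⟩ := exists_hasDerivAt_eq_slope (iterLog (m + 1))
    (fun x => 1 / logProd (m + 1) x) hlt
    (fun x hx => (hasDerivAt_iterLog (m + 1)
      (iterLog_pos_of_le h hx.1)).continuousAt.continuousWithinAt)
    (fun x hx => hasDerivAt_iterLog (m + 1) (iterLog_pos_of_le h hx.1.le))
  have hd' : iterLog (m + 1) ((n + 1 : ℕ) : ℝ) - iterLog (m + 1) (n : ℝ) =
      1 / logProd (m + 1) ξ := by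
    rw [hd]; push_cast; simp
  have hξp := iterLog_pos_of_le h hξ.1.le
  have h1 := one_div_le_one_div_of_le (logProd_pos h) (logProd_mono h hξ.1.le le_rfl)
  have h2 := one_div_le_one_div_of_le (logProd_pos hξp) (logProd_mono hξp hξ.2.le le_rfl)
  rw [hd', Real.norm_eq_abs, abs_of_nonneg (by linarith)]
  linarith

theorem summable_lamPrim_sub (k : ℕ) (B : ℝ) :
    Summable fun n : ℕ => lamPrim k B ((n + 1 : ℕ) : ℝ) - lamPrim k B (n : ℝ) -
      lamReal k B ((n + 1 : ℕ) : ℝ) := by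
  have h1 : Summable fun n : ℕ => ∑ j ∈ Finset.range k,
      (iterLog (j + 1) ((n + 1 : ℕ) : ℝ) - iterLog (j + 1) (n : ℝ) -
        1 / logProd (j + 1) ((n + 1 : ℕ) : ℝ)) :=
    summable_sum fun j _ => summable_iterLog_sub j
  refine (h1.add ((summable_iterLog_sub k).mul_left B)).congr fun n => ?_
  rw [lamPrim, lamPrim, lamReal, Finset.sum_sub_distrib, Finset.sum_sub_distrib]
  ring

theorem abs_lamReal_le {k : ℕ} {x : ℝ} (h : ∀ j < k + 1, 1 ≤ iterLog j x) (B : ℝ) :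
    |lamReal k B x| ≤ (k + |B|) / x := by
  have hx : 0 < x := one_pos.trans_le (h 0 (by omega))
  have hle : ∀ j < k + 1, 1 / logProd (j + 1) x ≤ 1 / x := fun j hj =>
    one_div_le_one_div_of_le hx (le_logProd_succ hx.le fun i hi _ => h i (by omega))
  have hpos : ∀ j < k + 1, 0 < logProd (j + 1) x := fun j hj =>
    logProd_pos fun i hi => one_pos.trans_le (h i (by omega))
  rw [lamReal, add_div]
  refine (abs_add_le _ _).trans (add_le_add ?_ ?_)
  · rw [abs_of_nonneg (Finset.sum_nonneg fun j hj => (one_div_pos.2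
      (hpos j (by have := Finset.mem_range.1 hj; omega))).le)]
    refine (Finset.sum_le_sum fun j hj => hle j
      (by have := Finset.mem_range.1 hj; omega)).trans ?_
    rw [Finset.sum_const, Finset.card_range, nsmul_eq_mul, mul_one_div]
  · rw [abs_div, abs_of_pos (hpos k (by omega)), div_eq_mul_one_div, div_eq_mul_one_div |B|]
    exact mul_le_mul_of_nonneg_left (hle k (by omega)) (abs_nonneg B)

theorem abs_log_div_add_le {x : ℝ} (hx : |x| ≤ 1 / 2) :
    |Real.log ((1 - x) / (1 + x)) + 2 * x| ≤ 4 * x ^ 2 := by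
  have hb := abs_le.1 hx
  have h1 := Real.abs_log_sub_add_sum_range_le (x := x) (by linarith) 1
  have h2 := Real.abs_log_sub_add_sum_range_le (x := -x) (by rw [abs_neg]; linarith) 1
  simp only [Finset.sum_range_one, abs_neg, sub_neg_eq_add] at h1 h2
  norm_num at h1 h2
  have h3 : x ^ 2 / (1 - |x|) ≤ 2 * x ^ 2 := by
    rw [div_le_iff₀ (by linarith)]
    nlinarith [sq_nonneg x]
  rw [Real.log_div (by linarith) (by linarith)]
  rw [abs_le] at h1 h2 ⊢
  constructor <;> linarith [h1.1, h1.2, h2.1, h2.2]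

/-- This is `abs_log_div_add_le` at `s * x / 2`; using only `s ^ 2 = 1` treats both signs at once.
-/
theorem abs_log_ratio_add_le {s x : ℝ} (hs : s ^ 2 = 1) (hx : |x| ≤ 1) :
    |Real.log ((1 - (1 / 2 + s * (x / 4))) / (1 / 2 + s * (x / 4))) + s * x| ≤ x ^ 2 := by
  have hs' : |s| = 1 := by
    rw [← sq_abs] at hs
    nlinarith [abs_nonneg s]
  have h := abs_log_div_add_le (x := s * x / 2) (by
    rw [abs_div, abs_mul, hs', abs_two]; linarith)
  have e1 : (1 - (1 / 2 + s * (x / 4))) / (1 / 2 + s * (x / 4)) =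
      (1 - s * x / 2) / (1 + s * x / 2) := by
    rw [show 1 - (1 / 2 + s * (x / 4)) = (1 - s * x / 2) / 2 by ring,
      show 1 / 2 + s * (x / 4) = (1 + s * x / 2) / 2 by ring, div_div_div_cancel_right₀ two_ne_zero]
  rw [e1]
  convert h using 2
  · ring
  · linear_combination (-x ^ 2) * hs

theorem prob_mem {s : ℝ} (hs : s ^ 2 = 1) (k : ℕ) (B : ℝ) (i : ℕ) :
    0 < 1 / 2 + s * r (k + 1) B i ∧ 1 / 2 + s * r (k + 1) B i < 1 := by
  have h : |s * r (k + 1) B i| < 1 / 2 := by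
    rw [abs_mul, show |s| = 1 by rw [← sq_abs] at hs; nlinarith [abs_nonneg s], one_mul]
    exact abs_r_lt k B i
  rw [abs_lt] at h
  constructor <;> linarith [h.1, h.2]

/-- The weights `∏ (1 - p_i) / p_i` of the walk with `p = 1 / 2 + s r`, `s = ± 1`, are
asymptotically `C exp (- s ∫ Λ)`. -/
theorem weight_isEquivalent {s : ℝ} (hs : s ^ 2 = 1) (k : ℕ) (B : ℝ) :
    ∃ C : ℝ, 0 < C ∧ weight (fun i => 1 / 2 + s * r (k + 1) B i) ~[atTop]
      fun n : ℕ => C * Real.exp (-(s * lamPrim k B n)) := by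
  set p : ℕ → ℝ := fun i => 1 / 2 + s * r (k + 1) B i with hp
  have hp01 : ∀ i, 1 ≤ i → 0 < p i ∧ p i < 1 := fun i _ => prob_mem hs k B i
  -- Convergence of `v` is the whole claim. Its increments split into the quadratic error of the
  -- logarithm, which is `O(1 / n²)`, and the error of comparing `∑ Λ` with its primitive.
  set v : ℕ → ℝ := fun n => Real.log (weight p n) + s * lamPrim k B n with hv
  have hincr : ∀ n, v (n + 1) - v n =
      (Real.log ((1 - p (n + 1)) / p (n + 1)) + s * lamReal k B ((n + 1 : ℕ) : ℝ)) +
        s * (lamPrim k B ((n + 1 : ℕ) : ℝ) - lamPrim k B (n : ℝ) -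
          lamReal k B ((n + 1 : ℕ) : ℝ)) := by
    intro n
    have h1 := hp01 (n + 1) (by omega)
    simp only [hv]
    rw [weight_succ, Real.log_mul (weight_pos hp01 n).ne'
      (div_pos (by linarith) h1.1).ne']
    ring
  have hev : ∀ᶠ n : ℕ in atTop, ∀ j < k + 1, 1 ≤ iterLog j ((n : ℕ) : ℝ) :=
    (tendsto_natCast_atTop_atTop (R := ℝ)).eventually (eventually_iterLog_ge (k + 1) 1)
  have hsmall : ∀ᶠ n : ℕ in atTop, |lamReal k B (n : ℝ)| < 1 := by
    have h := (tendsto_lamReal k B).abs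
    rw [abs_zero] at h
    exact (tendsto_natCast_atTop_atTop (R := ℝ)).eventually (h.eventually_lt_const one_pos)
  have hsum1 : Summable fun n : ℕ =>
      Real.log ((1 - p (n + 1)) / p (n + 1)) + s * lamReal k B ((n + 1 : ℕ) : ℝ) := by
    have hmaj : Summable fun n : ℕ => ((k + |B|) ^ 2) * (1 / (n : ℝ) ^ 2) :=
      (Real.summable_one_div_nat_pow.2 one_lt_two).mul_left _
    refine (summable_nat_add_iff (f := fun n : ℕ => Real.log ((1 - p n) / p n) +
      s * lamReal k B (n : ℝ)) 1).2 ?_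
    refine Summable.of_norm_bounded_eventually_nat hmaj ?_
    filter_upwards [hev, hsmall, eventually_ge_atTop (i₀ (k + 1) B)] with n h1 h2 h3
    have hpn : p n = 1 / 2 + s * (lamReal k B n / 4) := by
      simp only [hp, r, if_pos h3, Lam_eq]
    rw [hpn, Real.norm_eq_abs]
    refine (abs_log_ratio_add_le hs h2.le).trans ?_
    rw [← sq_abs, mul_one_div, ← div_pow]
    exact pow_le_pow_left₀ (abs_nonneg _) (abs_lamReal_le h1 B) 2
  have hsum := (hsum1.add ((summable_lamPrim_sub k B).mul_left s)).congr
    fun n => (hincr n).symm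
  have hlim := hsum.hasSum.tendsto_sum_nat
  simp_rw [Finset.sum_range_sub] at hlim
  set l := ∑' n, (v (n + 1) - v n) with hl
  have hvlim : Tendsto v atTop (nhds (l + v 0)) := by
    simpa using hlim.add_const (v 0)
  refine ⟨Real.exp (l + v 0), Real.exp_pos _, ?_⟩
  have hW : ∀ n, weight p n = Real.exp (v n) * Real.exp (-(s * lamPrim k B n)) := by
    intro n
    rw [← Real.exp_add]
    simp only [hv, add_neg_cancel_right]
    rw [Real.exp_log (weight_pos hp01 n)]
  have h1 : (fun n => Real.exp (v n)) ~[atTop] fun _ => Real.exp (l + v 0) :=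
    (isEquivalent_const_iff_tendsto (Real.exp_pos _).ne').2
      ((Real.continuous_exp.tendsto _).comp hvlim)
  have h2 := h1.mul (IsEquivalent.refl (u := fun n : ℕ => Real.exp (-(s * lamPrim k B n))))
  refine h2.congr_left (Eventually.of_forall fun n => ?_)
  exact (hW n).symm

end Weight

end Lamperti

namespace Lamperti

/-! ### Comparison of sums with primitives. -/

section Sums

/-- A Stolz–Cesàro lemma: asymptotically equivalent increments give asymptotically equivalent
divergent sums. -/
theorem sum_isEquivalent_of_sub {w F : ℕ → ℝ} {c : ℝ} (hw : ∀ n, 0 < w n)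
    (hF : Tendsto F atTop atTop) (hc : 0 < c)
    (h : w ~[atTop] fun n => c * (F (n + 1) - F n)) :
    (fun n => ∑ j ∈ Finset.range n, w j) ~[atTop] fun n => c * F n := by
  have hdiv : Tendsto (fun n => ∑ j ∈ Finset.range n, w j) atTop atTop := by
    refine (not_summable_iff_tendsto_nat_atTop_of_nonneg fun n => (hw n).le).1 fun hs => ?_
    have h1 := (summable_of_isBigO_nat hs h.symm.isBigO).hasSum.tendsto_sum_nat
    simp_rw [← Finset.mul_sum, Finset.sum_range_sub] at h1
    exact not_tendsto_nhds_of_tendsto_atTop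
      ((tendsto_atTop_add_const_right atTop (-F 0) hF).const_mul_atTop hc) _ h1
  have ho := h.symm.isLittleO.sum_range (fun n => (hw n).le) hdiv
  -- Telescoping leaves the constant `c * F 0`, negligible against a divergent sum.
  have hconst : (fun _ : ℕ => c * F 0) =o[atTop] fun n => ∑ j ∈ Finset.range n, w j :=
    isLittleO_const_left.2 (Or.inr (tendsto_norm_atTop_atTop.comp hdiv))
  have h2 : (fun n => c * F n) ~[atTop] fun n => ∑ j ∈ Finset.range n, w j := by
    refine (ho.add hconst).congr_left fun n => ?_
    simp only [Pi.sub_apply]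
    rw [Finset.sum_sub_distrib, ← Finset.mul_sum, Finset.sum_range_sub]
    ring
  exact h2.symm

/-- If `F' ∼ exp (a L)` with `L' → 0` then the increments of `F` are equivalent
to `exp (a L)`. -/
theorem sub_isEquivalent_of_hasDerivAt {F F' L L' : ℝ → ℝ} {a : ℝ}
    (hF : ∀ᶠ x in atTop, HasDerivAt F (F' x) x) (hL : ∀ᶠ x in atTop, HasDerivAt L (L' x) x)
    (hL' : Tendsto L' atTop (nhds 0)) (hF' : F' ~[atTop] fun x => Real.exp (a * L x)) :
    (fun n : ℕ => F ((n + 1 : ℕ) : ℝ) - F (n : ℝ)) ~[atTop]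
      fun n : ℕ => Real.exp (a * L n) := by
  have mvt : ∀ {f f' : ℝ → ℝ}, (∀ᶠ x in atTop, HasDerivAt f (f' x) x) → ∀ᶠ x in atTop,
      ∀ y, x < y → ∃ ξ ∈ Set.Ioo x y, f y - f x = f' ξ * (y - x) := by
    intro f f' h
    obtain ⟨N, hN⟩ := eventually_atTop.1 h
    filter_upwards [eventually_ge_atTop N] with x hx y hxy
    obtain ⟨ξ, hξ, hd⟩ := exists_hasDerivAt_eq_slope f f' hxy
      (fun z hz => (hN z (hx.trans hz.1)).continuousAt.continuousWithinAt)
      (fun z hz => hN z (hx.trans hz.1.le))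
    refine ⟨ξ, hξ, ?_⟩
    rw [hd, div_mul_cancel₀ _ (sub_pos.2 hxy).ne']
  have hcast := tendsto_natCast_atTop_atTop (R := ℝ)
  have h1 : ∀ᶠ n : ℕ in atTop, ∃ ξ ∈ Set.Ioo (n : ℝ) ((n + 1 : ℕ) : ℝ),
      F ((n + 1 : ℕ) : ℝ) - F (n : ℝ) = F' ξ := by
    filter_upwards [hcast.eventually (mvt hF)] with n hn
    obtain ⟨ξ, hξ, he⟩ := hn _ (by simp : (n : ℝ) < ((n + 1 : ℕ) : ℝ))
    exact ⟨ξ, hξ, by rw [he]; push_cast; ring⟩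
  obtain ⟨ξ, hξ⟩ : ∃ ξ : ℕ → ℝ, ∀ᶠ n : ℕ in atTop, ξ n ∈ Set.Ioo (n : ℝ) ((n + 1 : ℕ) : ℝ) ∧
      F ((n + 1 : ℕ) : ℝ) - F (n : ℝ) = F' (ξ n) := by
    -- The default value `0` is used for only finitely many `n`.
    classical
    refine ⟨fun n => if h : ∃ ξ ∈ Set.Ioo (n : ℝ) ((n + 1 : ℕ) : ℝ),
      F ((n + 1 : ℕ) : ℝ) - F (n : ℝ) = F' ξ then h.choose else 0, ?_⟩
    filter_upwards [h1] with n hn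
    rw [dif_pos hn]
    exact hn.choose_spec
  have hξt : Tendsto ξ atTop atTop :=
    tendsto_atTop_mono' atTop (hξ.mono fun n h => h.1.1.le) hcast
  -- As `0 < ξ n - n < 1` and `L' → 0`, moving from `ξ n` to `n` changes `L` by `o(1)`, hence `exp
  -- (a * L)` by a factor tending to `1`.
  have h2 : Tendsto (fun n : ℕ => L (ξ n) - L n) atTop (nhds 0) := by
    rw [Metric.tendsto_atTop']
    intro ε hε
    have h3 : ∀ᶠ x in atTop, ∀ y, x ≤ y → |L' y| < ε := by
      have h := hL'.abs
      rw [abs_zero] at h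
      obtain ⟨N, hN⟩ := eventually_atTop.1 (h.eventually_lt_const hε)
      filter_upwards [eventually_ge_atTop N] with x hx y hy using hN y (hx.trans hy)
    obtain ⟨N, hN⟩ := eventually_atTop.1
      (hξ.and ((hcast.eventually (mvt hL)).and (hcast.eventually h3)))
    refine ⟨N, fun n hn => ?_⟩
    obtain ⟨⟨hx, -⟩, hm, hb⟩ := hN n hn.le
    obtain ⟨η, hη, he⟩ := hm _ hx.1
    have h4 : ξ n - n ≤ 1 := by
      have := hx.2
      push_cast at this
      linarith
    rw [Real.dist_eq, sub_zero, he, abs_mul, abs_of_pos (sub_pos.2 hx.1)]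
    exact (mul_le_of_le_one_right (abs_nonneg _) h4).trans_lt (hb η hη.1.le)
  have h5 : (fun n : ℕ => Real.exp (a * L (ξ n))) ~[atTop] fun n : ℕ => Real.exp (a * L n) := by
    refine (isEquivalent_iff_tendsto_one
      (Eventually.of_forall fun n => (Real.exp_pos _).ne')).2 ?_
    have h6 := (Real.continuous_exp.tendsto _).comp (h2.const_mul a)
    rw [mul_zero, Real.exp_zero] at h6
    refine h6.congr fun n => ?_
    simp only [Function.comp_apply, Pi.div_apply, ← Real.exp_sub, mul_sub]
  have h7 : (fun n => F' (ξ n)) ~[atTop] fun n => Real.exp (a * L (ξ n)) :=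
    hF'.comp_tendsto hξt
  exact (h7.congr_left (hξ.mono fun n h => h.2.symm)).trans h5

/-- The hypothesis `u = o(F)` makes the last increment of `S` negligible, so `S (n + 1)` is also
equivalent to `c * F n`. -/
theorem div_isEquivalent_of_isEquivalent {w S u F : ℕ → ℝ} {c : ℝ} (hc : 0 < c)
    (hS : ∀ n, S (n + 1) = S n + w n) (hw : w ~[atTop] fun n => c * u n)
    (hSF : S ~[atTop] fun n => c * F n) (huF : u =o[atTop] F) :
    (fun n => w n / (S n * S (n + 1))) ~[atTop] fun n => c⁻¹ * (u n / F n ^ 2) := by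
  have h1 : w =o[atTop] S := by
    have h2 : (fun n => c * u n) =o[atTop] fun n => c * F n :=
      (huF.const_mul_left c).const_mul_right hc.ne'
    exact (hw.isBigO.trans_isLittleO h2).trans_isBigO hSF.symm.isBigO
  have h2 : (fun n => S (n + 1)) ~[atTop] fun n => c * F n := by
    refine IsEquivalent.congr_left (u := S + w) ?_ (Eventually.of_forall fun n => (hS n).symm)
    exact (IsEquivalent.refl.add_isLittleO h1).trans hSF
  refine (hw.div (hSF.mul h2)).congr_right (Eventually.of_forall fun n => ?_)
  simp only [Pi.div_apply, Pi.mul_apply]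
  rcases eq_or_ne (F n) 0 with h | h
  · simp [h]
  · have := hc.ne'
    field_simp

end Sums

/-! ### The individual regimes. -/

section Asymptotics

variable {p : ℕ → ℝ}

theorem hasMaxAsymptotics_of_isEquivalent (hp : ∀ i, 1 ≤ i → 0 < p i ∧ p i < 1) {g : ℕ → ℝ}
    {c : ℝ} (hc : 0 < c)
    (h : (fun n => weight p n / (scale p n * scale p (n + 1))) ~[atTop] fun n => c / g n) :
    HasMaxAsymptotics.{u} p g := by
  refine ⟨c, hc, fun Ω _ μ _ X hX => h.congr_left ?_⟩
  filter_upwards [eventually_ge_atTop 2] with n hn using (measureReal_max_eq hp hX hn).symm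

/-- The walk `p = 1 / 2 + s r` with `s = ± 1` when `∑ exp (- s L)` diverges like `F`, `L` a
primitive of `Λ`. -/
theorem hasMaxAsymptotics_of_tendsto_atTop {s : ℝ} (hs : s ^ 2 = 1) {k : ℕ} {B : ℝ}
    {F F' : ℝ → ℝ} {g : ℕ → ℝ} {d : ℝ} (hd : 0 < d) (hF : Tendsto F atTop atTop)
    (hFF' : ∀ᶠ x in atTop, HasDerivAt F (F' x) x)
    (hF' : F' ~[atTop] fun x => Real.exp (-s * lamPrim k B x))
    (ho : (fun x => Real.exp (-s * lamPrim k B x)) =o[atTop] F)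
    (hg : ∀ᶠ n : ℕ in atTop, Real.exp (-s * lamPrim k B n) / F n ^ 2 = d / g n) :
    HasMaxAsymptotics.{u} (fun i => 1 / 2 + s * r (k + 1) B i) g := by
  have hp : ∀ i, 1 ≤ i → 0 < 1 / 2 + s * r (k + 1) B i ∧ 1 / 2 + s * r (k + 1) B i < 1 :=
    fun i _ => prob_mem hs k B i
  have hcast := tendsto_natCast_atTop_atTop (R := ℝ)
  obtain ⟨C, hC, hW⟩ := weight_isEquivalent hs k B
  have hL : ∀ᶠ x in atTop, HasDerivAt (lamPrim k B) (lamReal k B x) x := by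
    filter_upwards [eventually_iterLog_ge (k + 1) 1] with x hx
    exact hasDerivAt_lamPrim (fun j hj => one_pos.trans_le (hx j hj)) B
  simp_rw [← neg_mul] at hW
  have h1 := sub_isEquivalent_of_hasDerivAt hFF' hL (tendsto_lamReal k B) hF'
  have h2 : weight (fun i => 1 / 2 + s * r (k + 1) B i) ~[atTop]
      fun n : ℕ => C * (F ((n + 1 : ℕ) : ℝ) - F (n : ℝ)) :=
    hW.trans (IsEquivalent.refl.mul h1.symm)
  have h3 := sum_isEquivalent_of_sub (F := fun n : ℕ => F n) (weight_pos hp) (hF.comp hcast) hC h2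
  have h4 := div_isEquivalent_of_isEquivalent hC (scale_succ _) hW h3 (ho.comp_tendsto hcast)
  refine hasMaxAsymptotics_of_isEquivalent hp (mul_pos (inv_pos.2 hC) hd)
    (h4.congr_right ?_)
  filter_upwards [hg] with n hn
  rw [mul_div_assoc, ← hn]

/-- The walk `p = 1 / 2 + s r` with `s = ± 1` when `∑ exp (- s L)` converges, `L` a
primitive of `Λ`. -/
theorem hasMaxAsymptotics_of_summable {s : ℝ} (hs : s ^ 2 = 1) {k : ℕ} {B : ℝ} {g : ℕ → ℝ}
    (hsum : Summable fun n : ℕ => Real.exp (-s * lamPrim k B n))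
    (hg : ∀ᶠ n : ℕ in atTop, Real.exp (-s * lamPrim k B n) = 1 / g n) :
    HasMaxAsymptotics.{u} (fun i => 1 / 2 + s * r (k + 1) B i) g := by
  have hp : ∀ i, 1 ≤ i → 0 < 1 / 2 + s * r (k + 1) B i ∧ 1 / 2 + s * r (k + 1) B i < 1 :=
    fun i _ => prob_mem hs k B i
  obtain ⟨C, hC, hW⟩ := weight_isEquivalent hs k B
  simp_rw [← neg_mul] at hW
  have hWs : Summable (weight fun i => 1 / 2 + s * r (k + 1) B i) :=
    summable_of_isBigO_nat (hsum.mul_left C) hW.isBigO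
  set l := ∑' n, weight (fun i => 1 / 2 + s * r (k + 1) B i) n with hl
  have hlim : Tendsto (scale fun i => 1 / 2 + s * r (k + 1) B i) atTop (nhds l) :=
    hWs.hasSum.tendsto_sum_nat
  have hl0 : 0 < l := hWs.tsum_pos (fun n => (weight_pos hp n).le) 0 (weight_pos hp 0)
  have h1 := (isEquivalent_const_iff_tendsto hl0.ne').2 hlim
  have h2 := (isEquivalent_const_iff_tendsto hl0.ne').2 (hlim.comp (tendsto_add_atTop_nat 1))
  refine hasMaxAsymptotics_of_isEquivalent hp (c := C / (l * l)) (by positivity)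
    ((hW.div (h1.mul h2)).congr_right ?_)
  filter_upwards [hg] with n hn
  simp only [Pi.div_apply, Pi.mul_apply, Function.const_apply, hn]
  ring

theorem eventually_exp_neg_lamPrim (k : ℕ) (B : ℝ) :
    ∀ᶠ x in atTop, Real.exp (-1 * lamPrim k B x) = 1 / (logProd k x * iterLog k x ^ B) := by
  filter_upwards [eventually_iterLog_ge (k + 1) 1] with x hx
  rw [neg_one_mul, Real.exp_neg, exp_lamPrim fun j hj => one_pos.trans_le (hx j hj), one_div]

theorem hasDerivAt_iterLog_rpow {k : ℕ} {B x : ℝ} (hB : B ≠ 1) (hx : ∀ j < k + 1, 0 < iterLog j x) :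
    HasDerivAt (fun y => iterLog k y ^ (1 - B) / (1 - B))
      (1 / (logProd k x * iterLog k x ^ B)) x := by
  have hB' : 1 - B ≠ 0 := sub_ne_zero.2 hB.symm
  have h := ((hasDerivAt_iterLog k fun j hj => hx j (by omega)).rpow_const (p := 1 - B)
    (Or.inl (hx k (by omega)).ne')).div_const (1 - B)
  refine h.congr_deriv ?_
  have h1 : 0 < logProd k x := logProd_pos fun j hj => hx j (by omega)
  have h2 := Real.rpow_pos_of_pos (hx k (by omega)) B
  rw [show 1 - B - 1 = -B by ring, Real.rpow_neg (hx k (by omega)).le]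
  field_simp

theorem hasMaxAsymptotics_plus_eq_one (k : ℕ) :
    HasMaxAsymptotics.{u} (fun i => 1 / 2 + 1 * r (k + 1) 1 i)
      (fun n => logProd (k + 1) n * iterLog (k + 1) n ^ 2) := by
  have he : ∀ᶠ x in atTop, Real.exp (-1 * lamPrim k 1 x) = 1 / logProd (k + 1) x := by
    filter_upwards [eventually_exp_neg_lamPrim k 1] with x hx
    rw [hx, Real.rpow_one, ← logProd_succ]
  refine hasMaxAsymptotics_of_tendsto_atTop (one_pow 2) (F := iterLog (k + 1))
    (F' := fun x => 1 / logProd (k + 1) x) one_pos (tendsto_iterLog (k + 1)) ?_ ?_ ?_ ?_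
  · filter_upwards [eventually_iterLog_ge (k + 1) 1] with x hx
    exact hasDerivAt_iterLog (k + 1) fun j hj => one_pos.trans_le (hx j hj)
  · exact IsEquivalent.refl.congr_right (he.mono fun x hx => hx.symm)
  · have h1 : (fun x => 1 / logProd (k + 1) x) =o[atTop] fun _ => (1 : ℝ) :=
      (isLittleO_one_iff ℝ).2 ((tendsto_logProd k).const_div_atTop 1)
    have h2 : (fun _ : ℝ => (1 : ℝ)) =O[atTop] iterLog (k + 1) :=
      (isLittleO_const_left.2 (Or.inr
        (tendsto_norm_atTop_atTop.comp (tendsto_iterLog (k + 1))))).isBigO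
    exact (h1.trans_isBigO h2).congr' (he.mono fun x hx => hx.symm) EventuallyEq.rfl
  · filter_upwards [tendsto_natCast_atTop_atTop.eventually he] with n hn
    rw [hn, div_div]

/-- With exponent `1 - B < 0` the primitive of `exp (-L)` increases to `0`, so its increments are
summable, and with them the weights. -/
theorem hasMaxAsymptotics_plus_one_lt (k : ℕ) {B : ℝ} (hB : 1 < B) :
    HasMaxAsymptotics.{u} (fun i => 1 / 2 + 1 * r (k + 1) B i)
      (fun n => logProd k n * iterLog k n ^ B) := by
  have hcast := tendsto_natCast_atTop_atTop (R := ℝ)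
  have he := hcast.eventually (eventually_exp_neg_lamPrim k B)
  refine hasMaxAsymptotics_of_summable (one_pow 2) ?_ he
  have hpos : ∀ᶠ x : ℝ in atTop, ∀ j < k + 1, 0 < iterLog j x := by
    filter_upwards [eventually_iterLog_ge (k + 1) 1] with x hx j hj
    exact one_pos.trans_le (hx j hj)
  have h1 := sub_isEquivalent_of_hasDerivAt (a := -1) (L := lamPrim k B) (L' := lamReal k B)
    (F := fun y => iterLog k y ^ (1 - B) / (1 - B))
    (F' := fun x => 1 / (logProd k x * iterLog k x ^ B))
    (hpos.mono fun x hx => hasDerivAt_iterLog_rpow hB.ne' hx)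
    (hpos.mono fun x hx => hasDerivAt_lamPrim hx B) (tendsto_lamReal k B)
    (IsEquivalent.refl.congr_right ((eventually_exp_neg_lamPrim k B).mono fun x hx => hx.symm))
  have hlim : Tendsto (fun n : ℕ => -(iterLog k (n : ℝ) ^ (1 - B) / (1 - B))) atTop
      (nhds (-(0 / (1 - B)))) := by
    have h := (tendsto_rpow_neg_atTop (sub_pos.2 hB)).comp ((tendsto_iterLog k).comp hcast)
    rw [neg_sub] at h
    exact (h.div_const _).neg
  have hs := summable_sub_succ_of_antitone (a := fun n : ℕ =>
    -(iterLog k (n : ℝ) ^ (1 - B) / (1 - B))) ?_ hlim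
  · refine summable_of_isBigO_nat hs (h1.symm.isBigO.congr_right fun n => ?_)
    ring
  · filter_upwards [hcast.eventually hpos] with n hn
    have h2 : iterLog k ((n : ℕ) : ℝ) ≤ iterLog k ((n + 1 : ℕ) : ℝ) :=
      iterLog_mono hn (by simp) k (by omega)
    have h3 := Real.rpow_le_rpow_of_nonpos (hn k (by omega)) h2 (sub_nonpos.2 hB.le)
    rw [← div_neg, ← div_neg]
    exact div_le_div_of_nonneg_right h3 (by linarith)

/-- Here `F = (log_k)^(1 - B) / (1 - B)` diverges. Squaring it produces `d = (1 - B) ^ 2` and the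
exponent `B + 2 * (1 - B) = 2 - B`. -/
theorem hasMaxAsymptotics_plus_lt_one (k : ℕ) {B : ℝ} (hB : B < 1) :
    HasMaxAsymptotics.{u} (fun i => 1 / 2 + 1 * r (k + 1) B i)
      (fun n => logProd k n * iterLog k n ^ (2 - B)) := by
  have hB0 : 0 < 1 - B := sub_pos.2 hB
  have he := eventually_exp_neg_lamPrim k B
  have hpos : ∀ᶠ x : ℝ in atTop, ∀ j < k + 1, 0 < iterLog j x := by
    filter_upwards [eventually_iterLog_ge (k + 1) 1] with x hx j hj
    exact one_pos.trans_le (hx j hj)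
  refine hasMaxAsymptotics_of_tendsto_atTop (one_pow 2) (d := (1 - B) ^ 2) (pow_pos hB0 2)
    (F := fun y => iterLog k y ^ (1 - B) / (1 - B))
    (F' := fun x => 1 / (logProd k x * iterLog k x ^ B))
    (((tendsto_rpow_atTop hB0).comp (tendsto_iterLog k)).atTop_div_const hB0)
    (hpos.mono fun x hx => hasDerivAt_iterLog_rpow hB.ne hx)
    (IsEquivalent.refl.congr_right (he.mono fun x hx => hx.symm)) ?_ ?_
  -- The quotient of `exp (-L)` by `F` is exactly `(1 - B) / logProd (k + 1)`.
  · have h1 : (fun x => (1 - B) / logProd (k + 1) x) =o[atTop] fun _ => (1 : ℝ) :=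
      (isLittleO_one_iff ℝ).2 ((tendsto_logProd k).const_div_atTop (1 - B))
    have h2 := h1.mul_isBigO (isBigO_refl (fun y => iterLog k y ^ (1 - B) / (1 - B)) atTop)
    refine h2.congr' ?_ (Eventually.of_forall fun x => one_mul _)
    filter_upwards [he, hpos] with x hx hp
    have h3 : 0 < logProd k x := logProd_pos fun j hj => hp j (by omega)
    have h4 := hp k (by omega)
    have h5 := Real.rpow_pos_of_pos h4 B
    rw [hx, logProd_succ, Real.rpow_sub h4, Real.rpow_one]
    field_simp
  · have hcast := tendsto_natCast_atTop_atTop (R := ℝ)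
    filter_upwards [hcast.eventually he, hcast.eventually hpos] with n hx hp
    have h3 : 0 < logProd k (n : ℝ) := logProd_pos fun j hj => hp j (by omega)
    have h4 := hp k (by omega)
    have h5 := Real.rpow_pos_of_pos h4 B
    rw [hx, Real.rpow_sub h4, Real.rpow_sub h4, Real.rpow_one, Real.rpow_two]
    field_simp

/-- Only the leading term `1 / x` survives multiplication by `x`. The index `k + 1` ensures that its
coefficient is `1` and not `B`. -/
theorem tendsto_mul_lamReal (k : ℕ) (B : ℝ) :
    Tendsto (fun x => x * lamReal (k + 1) B x) atTop (nhds 1) := by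
  have hdiv : ∀ j, Tendsto (fun x => x / logProd (j + 2) x) atTop (nhds 0) := by
    intro j
    have h := (tendsto_iterLog (j + 1)).const_div_atTop 1
    refine squeeze_zero' ?_ ?_ h
    · filter_upwards [eventually_iterLog_ge (j + 2) 1] with x hx
      exact div_nonneg (zero_le_one.trans (hx 0 (by omega)))
        (logProd_pos fun i hi => one_pos.trans_le (hx i hi)).le
    · filter_upwards [eventually_iterLog_ge (j + 2) 1] with x hx
      have h1 : x ≤ logProd (j + 1) x :=
        le_logProd_succ (zero_le_one.trans (hx 0 (by omega))) fun i hi _ => hx i (by omega)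
      have h2 : 0 < x := one_pos.trans_le (hx 0 (by omega))
      have h3 : 0 < iterLog (j + 1) x := one_pos.trans_le (hx (j + 1) (by omega))
      rw [logProd_succ, div_le_div_iff₀ (mul_pos (h2.trans_le h1) h3) h3]
      nlinarith
  have h1 := (tendsto_finsetSum (Finset.range k) fun j _ => hdiv j).add
    (((hdiv k).const_mul B).add_const 1)
  simp only [Finset.sum_const_zero, mul_zero, zero_add] at h1
  refine h1.congr' ?_
  filter_upwards [eventually_gt_atTop 0] with x hx
  rw [lamReal, Finset.sum_range_succ', mul_add, mul_add, Finset.mul_sum]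
  have h2 : x * (1 / logProd (0 + 1) x) = 1 := by
    rw [logProd_succ, logProd_zero, iterLog, one_mul, mul_one_div_cancel hx.ne']
  rw [h2, add_assoc, add_comm (B * _) 1]
  congr 1
  · exact Finset.sum_congr rfl fun j _ => (mul_one_div _ _).symm
  · ring

/-- The term `log_{k+1} x` absorbs `B` times its own logarithm, whatever the sign of `B`. -/
theorem eventually_lamPrim_nonneg (k : ℕ) (B : ℝ) :
    ∀ᶠ x in atTop, 0 ≤ lamPrim (k + 1) B x := by
  have hlog : ∀ᶠ y : ℝ in atTop, |B * Real.log y| ≤ y := by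
    have h := (Real.isLittleO_log_id_atTop.const_mul_left B).bound one_pos
    filter_upwards [h, eventually_ge_atTop 0] with y hy h0
    simpa [abs_of_nonneg h0] using hy
  filter_upwards [eventually_iterLog_ge (k + 3) 1, (tendsto_iterLog (k + 1)).eventually hlog]
    with x hx h
  have h1 : 0 ≤ ∑ j ∈ Finset.range k, iterLog (j + 1) x := Finset.sum_nonneg fun j hj =>
    zero_le_one.trans (hx (j + 1) (by have := Finset.mem_range.1 hj; omega))
  have h2 := (abs_le.1 h).1
  rw [lamPrim, Finset.sum_range_succ]
  change 0 ≤ _ + B * Real.log (iterLog (k + 1) x)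
  linarith

/-- With `F = x * exp L / 2`, `F' = exp L * (1 + x * Λ) / 2 ∼ exp L`, and `exp L / F ^ 2 = 4 / (x ^
2 * exp L)`, whence `d = 4`. -/
theorem hasMaxAsymptotics_minus (k : ℕ) (B : ℝ) :
    HasMaxAsymptotics.{u} (fun i => 1 / 2 + -1 * r (k + 2) B i)
      (fun n => (n : ℝ) ^ 2 * logProd (k + 1) n * iterLog (k + 1) n ^ B) := by
  have hpos : ∀ᶠ x : ℝ in atTop, ∀ j < k + 1 + 1, 0 < iterLog j x := by
    filter_upwards [eventually_iterLog_ge (k + 2) 1] with x hx j hj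
    exact one_pos.trans_le (hx j hj)
  have hexp : ∀ x, Real.exp (- -1 * lamPrim (k + 1) B x) = Real.exp (lamPrim (k + 1) B x) := by
    intro x; rw [neg_neg, one_mul]
  refine hasMaxAsymptotics_of_tendsto_atTop (by norm_num) (k := k + 1) (d := 4) four_pos
    (F := fun x => x * Real.exp (lamPrim (k + 1) B x) / 2)
    (F' := fun x => (1 * Real.exp (lamPrim (k + 1) B x) +
      x * (Real.exp (lamPrim (k + 1) B x) * lamReal (k + 1) B x)) / 2) ?_ ?_ ?_ ?_ ?_
  · refine tendsto_atTop_mono' atTop ?_ (tendsto_id.atTop_div_const two_pos)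
    filter_upwards [eventually_lamPrim_nonneg k B, eventually_ge_atTop 0] with x h1 h2
    have := le_mul_of_one_le_right h2 (Real.one_le_exp h1)
    simp only [id]
    linarith
  · filter_upwards [hpos] with x hx
    exact ((hasDerivAt_id x).mul (hasDerivAt_lamPrim hx B).exp).div_const 2
  · refine (isEquivalent_iff_tendsto_one
      (Eventually.of_forall fun n => (Real.exp_pos _).ne')).2 ?_
    have h := ((tendsto_mul_lamReal k B).const_add 1).div_const 2
    norm_num at h
    refine h.congr fun x => ?_
    simp only [Pi.div_apply, hexp]
    have := (Real.exp_pos (lamPrim (k + 1) B x)).ne'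
    field_simp
  · simp only [hexp]
    have h1 : (fun x : ℝ => 2 / x) =o[atTop] fun _ => (1 : ℝ) :=
      (isLittleO_one_iff ℝ).2 (tendsto_id.const_div_atTop 2)
    have h2 := h1.mul_isBigO
      (isBigO_refl (fun x => x * Real.exp (lamPrim (k + 1) B x) / 2) atTop)
    refine h2.congr' ?_ (Eventually.of_forall fun x => one_mul _)
    filter_upwards [eventually_gt_atTop 0] with x hx
    field_simp
  · filter_upwards [tendsto_natCast_atTop_atTop.eventually hpos, eventually_gt_atTop 0]
      with n hx hn
    have hn' : (0 : ℝ) < n := Nat.cast_pos.2 hn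
    have h3 := Real.exp_pos (lamPrim (k + 1) B n)
    rw [hexp, mul_assoc, ← exp_lamPrim hx]
    field_simp
    norm_num

/-- For `K = 1`, `Λ` is odd in `B`, while `i₀` sees only `|Λ|`. -/
theorem r_one_neg (B : ℝ) (i : ℕ) : r 1 (-B) i = -r 1 B i := by
  have h : ∀ j, Lam 1 j (-B) = -Lam 1 j B := fun j => by simp [Lam, neg_div]
  have h0 : i₀ 1 (-B) = i₀ 1 B := by simp only [i₀, h, abs_neg]
  simp only [r, h0, h]
  split_ifs <;> ring

end Asymptotics

end Lamperti

theorem mainTheorem1 (K : ℕ) (hK : 1 ≤ K) (B : ℝ) :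
    -- case (i): `p_i = 1/2 + r_i`
    ((B = 1 → Lamperti.HasMaxAsymptotics.{u} (fun i => 1 / 2 + Lamperti.r K B i)
        (fun n => Lamperti.logProd K n * Lamperti.iterLog K n ^ 2)) ∧
      (1 < B → Lamperti.HasMaxAsymptotics.{u} (fun i => 1 / 2 + Lamperti.r K B i)
        (fun n => Lamperti.logProd (K - 1) n * Lamperti.iterLog (K - 1) n ^ B)) ∧
      (B < 1 → Lamperti.HasMaxAsymptotics.{u} (fun i => 1 / 2 + Lamperti.r K B i)
        (fun n => Lamperti.logProd (K - 1) n * Lamperti.iterLog (K - 1) n ^ (2 - B)))) ∧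
    -- case (ii): `p_i = 1/2 - r_i`
    ((K = 1 → -1 < B → Lamperti.HasMaxAsymptotics.{u} (fun i => 1 / 2 - Lamperti.r K B i)
        (fun n => (n : ℝ) ^ (B + 2))) ∧
      (K = 1 → B = -1 → Lamperti.HasMaxAsymptotics.{u} (fun i => 1 / 2 - Lamperti.r K B i)
        (fun n => (n : ℝ) * Real.log n ^ 2)) ∧
      (K = 1 → B < -1 → Lamperti.HasMaxAsymptotics.{u} (fun i => 1 / 2 - Lamperti.r K B i)
        (fun n => (n : ℝ) ^ (-B))) ∧
      (1 < K → Lamperti.HasMaxAsymptotics.{u} (fun i => 1 / 2 - Lamperti.r K B i)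
        (fun n => (n : ℝ) ^ 2 * Lamperti.logProd (K - 1) n *
          Lamperti.iterLog (K - 1) n ^ B))) := by
  obtain ⟨k, rfl⟩ : ∃ k, K = k + 1 := ⟨K - 1, by omega⟩
  simp only [Nat.add_sub_cancel]
  refine ⟨⟨?_, fun hB => ?_, fun hB => ?_⟩, ?_, ?_, ?_, fun hk => ?_⟩
  · rintro rfl
    simpa only [one_mul] using Lamperti.hasMaxAsymptotics_plus_eq_one k
  · simpa only [one_mul] using Lamperti.hasMaxAsymptotics_plus_one_lt k hB
  · simpa only [one_mul] using Lamperti.hasMaxAsymptotics_plus_lt_one k hB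
  · intro hk hB
    obtain rfl : k = 0 := by omega
    -- Case (i) at `-B`: the exponent `2 - (-B)` is `B + 2`.
    have h := Lamperti.hasMaxAsymptotics_plus_lt_one.{u} 0 (B := -B) (by linarith)
    simpa only [one_mul, zero_add, Lamperti.r_one_neg, ← sub_eq_add_neg, Lamperti.logProd_zero,
      Lamperti.iterLog, sub_neg_eq_add, add_comm (2 : ℝ)] using h
  · rintro hk rfl
    obtain rfl : k = 0 := by omega
    have h := Lamperti.hasMaxAsymptotics_plus_eq_one.{u} 0
    simpa only [one_mul, zero_add, Lamperti.r_one_neg, sub_neg_eq_add,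
      Lamperti.logProd_succ, Lamperti.logProd_zero, Lamperti.iterLog] using h
  · intro hk hB
    obtain rfl : k = 0 := by omega
    have h := Lamperti.hasMaxAsymptotics_plus_one_lt.{u} 0 (B := -B) (by linarith)
    simpa only [one_mul, zero_add, Lamperti.r_one_neg, ← sub_eq_add_neg, Lamperti.logProd_zero,
      Lamperti.iterLog] using h
  · obtain ⟨m, rfl⟩ : ∃ m, k = m + 1 := ⟨k - 1, by omega⟩
    simpa only [neg_one_mul, ← sub_eq_add_neg] using Lamperti.hasMaxAsymptotics_minus m B
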